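/- Let $X$ be a finite set and $Y\subseteq X$. A \emph{metric} on a set $Z$ here means a function $d:Z\times Z\to\mathbb R$ with $d(i,j)\ge 0$, $d(i,i)=0$, $d(i,j)=d(j,i)$ and $d(i,k)\le d(i,j)+d(j,k)$ for all $i,j,k\in Z$ (distinct points may have distance $0$); $\mathcal D_Z$ is the set of all metrics on $Z$. A metric $d_X\in\mathcal D_X$ is an \emph{extension} of $d_Y\in\mathcal D_Y$ if $d_X(p,q)=d_Y(p,q)$ for all $p,q\in Y$. For nonnegative weights $\alpha=(\alpha_{ij})_{i,j\in X}$ put $\alpha(d)=\sum_{i,j\in X}\alpha_{ij}d(i,j)$, and let $$\operatorname{minext}_{Y\to X}(d_Y,\alpha)=\min\{\alpha(d_X): d_X\in\mathcal D_X \text{ is an extension of } d_Y\}.$$ A family of coefficients $\phi=(\phi_{ipjq})_{i,j\in X,\;p,q\in Y}$ with the associated linear operator $$\phi(d_Y)(i,j)=\sum_{p,q\in Y}\phi_{ipjq}\,d_Y(p,q)$$ is a \emph{metric extension operator with distortion $Q$} with respect to $\alpha$ if * for every $d_Y\in\mathcal D_Y$, $\phi(d_Y)$ is a metric on $X$ and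 an extension of $d_Y$; * for every $d_Y\in\mathcal D_Y$, $\alpha(\phi(d_Y))\le Q\cdot\operatorname{minext}_{Y\to X}(d_Y,\alpha)$; * $\phi_{ipjq}\ge 0$ for all $i,j\in X$ and $p,q\in Y$. **Theorem.** There is a function $Q:\mathbb N\to\mathbb R$ with $Q(k)=O\!\left(\frac{\log k}{\log\log k}\right)$ as $k\to\infty$ such that for every finite set $X$, every $k\ge 0$, every $k$-point subset $Y\subseteq X$ and all nonnegative weights $\alpha_{ij}$, $(i,j)\in X\times X$, there exists a metric extension operator $\phi:\mathcal D_Y\to\mathcal D_X$ with respect to $\alpha$ with distortion $Q(k)$. -/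

import Mathlib

/-- `d` is a metric on `X` in the sense used here: a nonnegative symmetric function that vanishes
on the diagonal and satisfies the triangle inequality. Distinct points may be at distance `0`. -/
structure IsSemimetric {X : Type*} (d : X → X → ℝ) : Prop where
  nonneg : ∀ i j, 0 ≤ d i j
  self : ∀ i, d i i = 0
  symm : ∀ i j, d i j = d j i
  triangle : ∀ i j k, d i k ≤ d i j + d j k

/-- `dX` is a metric extension to `X` of the metric `dY` on the subset `Y`. -/
structure IsMetricExtension {X : Type*} {Y : Finset X} (dY : Y → Y → ℝ) (dX : X → X → ℝ) :
    Prop where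
  isSemimetric : IsSemimetric dX
  restrict_eq : ∀ p q : Y, dX p q = dY p q

/-- The linear functional `α(d) = ∑ i j, α i j * d i j`. -/
def metricCost {X : Type*} [Fintype X] (α d : X → X → ℝ) : ℝ :=
  ∑ i, ∑ j, α i j * d i j

/-- The minimum of `α(dX)` over all metric extensions `dX` of `dY` to `X`.
For a metric `dY` and nonnegative weights the infimum is attained, see `isLeast_minExt`. -/
noncomputable def minExt {X : Type*} [Fintype X] {Y : Finset X} (dY : Y → Y → ℝ)
    (α : X → X → ℝ) : ℝ :=
  sInf (metricCost α '' {dX | IsMetricExtension dY dX})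

/-- The linear operator with coefficients `φ i p j q`:
`φ(dY)(i, j) = ∑ p q, φ i p j q * dY p q`, with `p, q` ranging over `Y`. -/
def applyOperator {X : Type*} {Y : Finset X} (φ : X → Y → X → Y → ℝ) (dY : Y → Y → ℝ) :
    X → X → ℝ :=
  fun i j => ∑ p, ∑ q, φ i p j q * dY p q

/-- `φ` is (the coefficient array of) a `Q`-distortion metric extension operator with respect to
the weights `α`. -/
structure IsMetricExtensionOperator {X : Type*} [Fintype X] {Y : Finset X} (α : X → X → ℝ)
    (Q : ℝ) (φ : X → Y → X → Y → ℝ) : Prop where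
  isMetricExtension : ∀ dY : Y → Y → ℝ, IsSemimetric dY →
    IsMetricExtension dY (applyOperator φ dY)
  cost_le : ∀ dY : Y → Y → ℝ, IsSemimetric dY →
    metricCost α (applyOperator φ dY) ≤ Q * minExt dY α
  coeff_nonneg : ∀ i p j q, 0 ≤ φ i p j q

theorem exists_isMetricExtension {X : Type*} {Y : Finset X} {dY : Y → Y → ℝ}
    (hd : IsSemimetric dY) : ∃ dX, IsMetricExtension dY dX := by
  classical
  by_cases hY : Nonempty Y
  · obtain ⟨p₀⟩ := hY
    let f : X → Y := fun x => if h : x ∈ Y then ⟨x, h⟩ else p₀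
    refine ⟨fun i j => dY (f i) (f j), ⟨fun _ _ => hd.nonneg _ _, fun _ => hd.self _,
      fun _ _ => hd.symm _ _, fun _ _ _ => hd.triangle _ _ _⟩, fun p q => ?_⟩
    simp [f]
  · refine ⟨fun _ _ => 0, ⟨by simp, by simp, by simp, by simp⟩, fun p => (hY ⟨p⟩).elim⟩

/-- The minimum extension exists: `minExt dY α` is the cost of some metric extension of `dY`
and a lower bound for the cost of all of them. -/
theorem isLeast_minExt {X : Type*} [Fintype X] {Y : Finset X} {dY : Y → Y → ℝ}
    {α : X → X → ℝ} (hd : IsSemimetric dY) (hα : ∀ i j, 0 ≤ α i j) :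
    IsLeast (metricCost α '' {dX | IsMetricExtension dY dX}) (minExt dY α) := by
  set M : ℝ := ∑ p, ∑ q, dY p q with hM
  have hM0 : 0 ≤ M := Finset.sum_nonneg fun p _ => Finset.sum_nonneg fun q _ => hd.nonneg p q
  have hdM : ∀ p q, dY p q ≤ M := fun p q =>
    (Finset.single_le_sum (f := fun q => dY p q) (fun q _ => hd.nonneg p q)
      (Finset.mem_univ q)).trans
    (Finset.single_le_sum (f := fun p => ∑ q, dY p q)
      (fun p _ => Finset.sum_nonneg fun q _ => hd.nonneg p q) (Finset.mem_univ p))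
  have htr : ∀ dX, IsMetricExtension dY dX → IsMetricExtension dY fun i j => min (dX i j) M := by
    intro dX h
    refine ⟨⟨fun i j => le_min (h.1.nonneg i j) hM0, fun i => ?_, fun i j => ?_,
      fun i j k => ?_⟩, fun p q => ?_⟩
    · simp [h.1.self i, hM0]
    · simp [h.1.symm i j]
    · have h1 := h.1.triangle i j k
      have h2 := h.1.nonneg i j
      have h3 := h.1.nonneg j k
      grind
    · simp [h.2 p q, hdM p q]
  let S : Set (X → X → ℝ) := {dX | IsMetricExtension dY dX} ∩ Set.Icc 0 (fun _ _ => M)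
  have hcl : IsClosed {dX : X → X → ℝ | IsMetricExtension dY dX} := by
    have : {dX : X → X → ℝ | IsMetricExtension dY dX} =
        {d | ∀ i j, 0 ≤ d i j} ∩ {d | ∀ i, d i i = 0} ∩ {d | ∀ i j, d i j = d j i} ∩
        {d | ∀ i j k, d i k ≤ d i j + d j k} ∩ {d | ∀ p q : Y, d p q = dY p q} := by
      ext d
      exact ⟨fun h => ⟨⟨⟨⟨h.1.1, h.1.2⟩, h.1.3⟩, h.1.4⟩, h.2⟩,
        fun h => ⟨⟨h.1.1.1.1, h.1.1.1.2, h.1.1.2, h.1.2⟩, h.2⟩⟩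
    rw [this]
    simp only [Set.ofPred_forall]
    refine ((((?_ : IsClosed _).inter ?_).inter ?_).inter ?_).inter ?_
    · exact isClosed_iInter fun i => isClosed_iInter fun j =>
        isClosed_le (by fun_prop) (by fun_prop)
    · exact isClosed_iInter fun i => isClosed_eq (by fun_prop) (by fun_prop)
    · exact isClosed_iInter fun i => isClosed_iInter fun j =>
        isClosed_eq (by fun_prop) (by fun_prop)
    · exact isClosed_iInter fun i => isClosed_iInter fun j => isClosed_iInter fun k =>
        isClosed_le (by fun_prop) (by fun_prop)
    · exact isClosed_iInter fun p => isClosed_iInter fun q =>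
        isClosed_eq (by fun_prop) (by fun_prop)
  have hS : IsCompact S := isCompact_Icc.inter_left hcl
  have hmem : ∀ dX, IsMetricExtension dY dX → (fun i j => min (dX i j) M) ∈ S := fun dX h =>
    ⟨htr dX h, fun i j => (htr dX h).1.nonneg i j, fun i j => min_le_right _ _⟩
  obtain ⟨d₀, h₀⟩ := exists_isMetricExtension hd
  have hcont : Continuous (metricCost α) := by
    unfold metricCost
    fun_prop
  obtain ⟨d₁, h₁, hmin⟩ := hS.exists_isMinOn ⟨_, hmem d₀ h₀⟩ hcont.continuousOn
  have hleast : IsLeast (metricCost α '' {dX | IsMetricExtension dY dX}) (metricCost α d₁) := by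
    refine ⟨⟨d₁, h₁.1, rfl⟩, ?_⟩
    rintro _ ⟨d, h, rfl⟩
    refine (isMinOn_iff.mp hmin _ (hmem d h)).trans ?_
    exact Finset.sum_le_sum fun i _ => Finset.sum_le_sum fun j _ =>
      mul_le_mul_of_nonneg_left (min_le_left _ _) (hα i j)
  have : minExt dY α = metricCost α d₁ := hleast.csInf_eq
  rw [this]
  exact hleast

/-! A retraction of X onto Y pulls metrics on Y back to extensions on X. Suppose every semimetric
`d` admits a retraction multiplying its cost by at most Q. By minimax
(`exists_convex_combination_nonpos`) a single probability distribution on retractions then works for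
all `d` at once, and the averaged pullback is the required linear operator
(`exists_isMetricExtensionOperator`).

The retraction for a given `d` is random (`exists_retraction_metricCost_le`). Take a random order on
Y and a grid of radii exp(u + iL) with u uniform in [0, L]. A point outside Y goes to the first
target within its distance to Y, rounded up to the grid. Let x, y have distances a ≤ b to Y and put
δ = d(x, y), small against b. Their radii differ with probability at most δ/(aL), at a cost of order
e^L a. If both radii equal R, a target t separates x from y only if R falls in a window of length δ
and t precedes all targets at least as near; the latter has probability at most 1/rank(t), and these
sum to a harmonic number. The expected cost is at most (1 + (4e^L + 2H_k)/L) δ, and L = log log k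
balances e^L against H_k. -/

/-! ### Random orders on the targets -/

-- Composing with the swap of `t` and `t'` injects the orders where `t` is first in `S` into those
-- where `t'` is; for distinct elements of `S` these families are disjoint.
open Finset in
theorem card_mul_card_filter_first_le {T : Type*} [Fintype T] [DecidableEq T] {S : Finset T} {t : T}
    (ht : t ∈ S) :
    S.card * (univ.filter fun σ : T ≃ Fin (Fintype.card T) => ∀ t' ∈ S, σ t ≤ σ t').card ≤
      Fintype.card (T ≃ Fin (Fintype.card T)) := by
  set N : T → Finset (T ≃ Fin (Fintype.card T)) :=
    fun t => univ.filter fun σ => ∀ t' ∈ S, σ t ≤ σ t' with hN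
  have key : ∀ t' ∈ S, (N t).card ≤ (N t').card := by
    intro t' ht'
    refine card_le_card_of_injOn (fun σ => (Equiv.swap t t').trans σ) ?_ ?_
    · intro σ hσ
      simp only [hN, coe_filter, mem_univ, true_and, Set.mem_ofPred_eq, Equiv.trans_apply,
        Equiv.swap_apply_right] at hσ ⊢
      intro s hs
      apply hσ
      rcases eq_or_ne s t with rfl | h1
      · simpa using ht'
      · rcases eq_or_ne s t' with rfl | h2
        · simpa using ht
        · rwa [Equiv.swap_apply_of_ne_of_ne h1 h2]
    · intro σ _ τ _ h
      ext s
      have := congrArg (fun e : T ≃ Fin (Fintype.card T) => e (Equiv.swap t t' s)) h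
      simpa using congrArg Fin.val this
  calc S.card * (N t).card = ∑ t' ∈ S, (N t).card := by simp
    _ ≤ ∑ t' ∈ S, (N t').card := sum_le_sum key
    _ = (S.biUnion N).card := by
        rw [card_biUnion]
        intro a ha b hb hab
        rw [Function.onFun, disjoint_left]
        intro σ h1 h2
        simp only [hN, mem_filter, mem_univ, true_and] at h1 h2
        exact hab (σ.injective (le_antisymm (h1 b hb) (h2 a ha)))
    _ ≤ _ := card_le_univ _

-- Without ties the cardinalities are 1, ..., |s|; ties only enlarge them.
open Finset in
theorem sum_inv_card_filter_le_harmonic {T : Type*} [DecidableEq T] (m : T → ℝ) (s : Finset T) :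
    ∑ t ∈ s, ((s.filter fun t' => m t' ≤ m t).card : ℝ)⁻¹ ≤ harmonic s.card := by
  induction s using Finset.induction_on_max_value m with
  | empty => simp
  | insert a s ha hmax ih =>
    rw [sum_insert ha, card_insert_of_notMem ha, harmonic_succ]
    have h1 : (insert a s).filter (fun t' => m t' ≤ m a) = insert a s := by
      rw [filter_eq_self]
      intro t ht
      rcases mem_insert.1 ht with rfl | h
      · rfl
      · exact hmax t h
    rw [h1, card_insert_of_notMem ha, add_comm]
    push_cast
    gcongr
    refine (sum_le_sum fun t ht => ?_).trans ih
    have h2 : 0 < (s.filter fun t' => m t' ≤ m t).card :=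
      card_pos.2 ⟨t, by simp [ht]⟩
    gcongr
    exact subset_insert a s

open Finset in
/-- Two points whose sets of admissible targets are `{p ≤ R}` and `{q ≤ R}` and that pick the first
admissible target in a random order are rarely separated. -/
theorem card_filter_first_ne_le {T : Type*} [Fintype T] [DecidableEq T] {p q : T → ℝ} {R δ : ℝ}
    (hpq : ∀ t, |p t - q t| ≤ δ) (g h : (T ≃ Fin (Fintype.card T)) → T)
    (hg : ∀ σ, p (g σ) ≤ R) (hg' : ∀ (σ : T ≃ Fin (Fintype.card T)) t, p t ≤ R → σ (g σ) ≤ σ t)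
    (hh : ∀ σ, q (h σ) ≤ R) (hh' : ∀ (σ : T ≃ Fin (Fintype.card T)) t, q t ≤ R → σ (h σ) ≤ σ t) :
    ((univ.filter fun σ => g σ ≠ h σ).card : ℝ) ≤
      Fintype.card (T ≃ Fin (Fintype.card T)) *
      ∑ t, ((univ.filter fun t' => min (p t') (q t') ≤ min (p t) (q t)).card : ℝ)⁻¹ *
        (if min (p t) (q t) ≤ R ∧ R < min (p t) (q t) + δ then 1 else 0) := by
  set m : T → ℝ := fun t => min (p t) (q t) with hm
  set B : Finset T := univ.filter fun t => m t ≤ R ∧ R < m t + δ with hB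
  set N : T → Finset (T ≃ Fin (Fintype.card T)) := fun t =>
    univ.filter fun σ => ∀ t' ∈ univ.filter (fun t' => m t' ≤ m t), σ t ≤ σ t' with hN
  -- The earlier of two different choices is admissible for one point only, which puts `R` in its
  -- window. It precedes every `t'` with `m t' ≤ m t`, since such a `t'` is admissible for at least
  -- one of the points.
  have hsub : (univ.filter fun σ => g σ ≠ h σ) ⊆ B.biUnion N := by
    intro σ hσ
    have hne : g σ ≠ h σ := by simpa using hσ
    have aux : ∀ t, m t ≤ R → p t ≤ R ∨ q t ≤ R := fun t ht => min_le_iff.1 ht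
    rw [mem_biUnion]
    rcases le_total (σ (g σ)) (σ (h σ)) with hle | hle
    · have h1 : R < q (g σ) := by
        by_contra! hc
        exact hne (σ.injective (le_antisymm hle (hh' σ _ hc)))
      have h2 : m (g σ) ≤ R := (min_le_left _ _).trans (hg σ)
      refine ⟨g σ, ?_, ?_⟩
      · have := abs_le.1 (hpq (g σ))
        have h3 := hg σ
        have h4 : m (g σ) = p (g σ) := min_eq_left (by linarith)
        simp only [hB, mem_filter, mem_univ, true_and]
        exact ⟨h2, by rw [h4]; linarith⟩
      · simp only [hN, mem_filter, mem_univ, true_and]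
        intro t ht
        rcases aux t (ht.trans h2) with h5 | h5
        · exact hg' σ t h5
        · exact hle.trans (hh' σ t h5)
    · have h1 : R < p (h σ) := by
        by_contra! hc
        exact hne (σ.injective (le_antisymm (hg' σ _ hc) hle))
      have h2 : m (h σ) ≤ R := (min_le_right _ _).trans (hh σ)
      refine ⟨h σ, ?_, ?_⟩
      · have := abs_le.1 (hpq (h σ))
        have h3 := hh σ
        have h4 : m (h σ) = q (h σ) := min_eq_right (by linarith)
        simp only [hB, mem_filter, mem_univ, true_and]
        exact ⟨h2, by rw [h4]; linarith⟩
      · simp only [hN, mem_filter, mem_univ, true_and]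
        intro t ht
        rcases aux t (ht.trans h2) with h5 | h5
        · exact hle.trans (hg' σ t h5)
        · exact hh' σ t h5
  have hNt : ∀ t, ((N t).card : ℝ) ≤ Fintype.card (T ≃ Fin (Fintype.card T)) *
      ((univ.filter fun t' => m t' ≤ m t).card : ℝ)⁻¹ := by
    intro t
    have ht : t ∈ univ.filter fun t' => m t' ≤ m t := by simp
    have h0 : (0 : ℝ) < ((univ.filter fun t' => m t' ≤ m t).card : ℝ) := by
      exact_mod_cast card_pos.2 ⟨t, ht⟩
    rw [← div_eq_mul_inv, le_div_iff₀ h0, mul_comm]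
    exact_mod_cast card_mul_card_filter_first_le ht
  calc ((univ.filter fun σ => g σ ≠ h σ).card : ℝ) ≤ ((B.biUnion N).card : ℝ) := by
        exact_mod_cast card_le_card hsub
    _ ≤ ∑ t ∈ B, ((N t).card : ℝ) := by exact_mod_cast card_biUnion_le
    _ ≤ ∑ t ∈ B, Fintype.card (T ≃ Fin (Fintype.card T)) *
          ((univ.filter fun t' => m t' ≤ m t).card : ℝ)⁻¹ := sum_le_sum fun t _ => hNt t
    _ = _ := by
        rw [hB, sum_filter, mul_sum]
        refine sum_congr rfl fun t _ => ?_
        simp only [hm]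
        split_ifs <;> simp only [mul_one, mul_zero]

/-! ### Convex duality -/

/-- A finite minimax principle. -/
theorem exists_convex_combination_nonpos {F E : Type*} [Fintype F] [AddCommGroup E] [Module ℝ E]
    {C : Set E} (hC : Convex ℝ C) (hne : C.Nonempty) (l : F → E →ₗ[ℝ] ℝ)
    (h : ∀ d ∈ C, ∃ f, l f d ≤ 0) :
    ∃ w : F → ℝ, (∀ f, 0 ≤ w f) ∧ ∑ f, w f = 1 ∧ ∀ d ∈ C, ∑ f, w f * l f d ≤ 0 := by
  classical
  let P : Set (F → ℝ) := Set.univ.pi fun _ => Set.Ioi 0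
  have hP : Convex ℝ P := convex_pi fun _ _ => convex_Ioi 0
  have hPo : IsOpen P := isOpen_set_pi Set.finite_univ fun _ _ => isOpen_Ioi
  have hS : Convex ℝ (LinearMap.pi l '' C) := hC.linear_image _
  have hdisj : Disjoint P (LinearMap.pi l '' C) := by
    rw [Set.disjoint_left]
    rintro _ hx ⟨d, hd, rfl⟩
    obtain ⟨f, hf⟩ := h d hd
    exact absurd (hx f trivial) (not_lt.2 hf)
  -- Separating the image of `C` from the open positive orthant gives a functional whose
  -- coefficients, negated and normalised, are the weights.
  obtain ⟨φ, c, hφ, hc⟩ := geometric_hahn_banach_open hP hPo hS hdisj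
  have hexp : ∀ x : F → ℝ, φ x = ∑ f, x f * φ (Pi.single f 1) := by
    intro x
    conv_lhs => rw [pi_eq_sum_univ' x]
    simp [map_sum]
  have hcl : ∀ x : F → ℝ, (∀ f, 0 ≤ x f) → φ x ≤ c := by
    intro x hx
    have ht : Filter.Tendsto (fun ε : ℝ => φ (x + ε • 1)) (nhdsWithin 0 (Set.Ioi 0))
        (nhds (φ x)) := by
      have : Continuous fun ε : ℝ => φ (x + ε • 1) := by fun_prop
      have h2 := this.tendsto 0
      simp only [zero_smul, add_zero] at h2
      exact h2.mono_left nhdsWithin_le_nhds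
    refine le_of_tendsto ht ?_
    filter_upwards [self_mem_nhdsWithin] with ε hε
    refine (hφ _ fun f _ => ?_).le
    have : (0 : ℝ) < ε := hε
    simpa using add_pos_of_nonneg_of_pos (hx f) this
  have hc0 : 0 ≤ c := by simpa using hcl 0 (fun _ => le_rfl)
  -- A positive coefficient would make `φ` unbounded above on the orthant.
  have hw : ∀ f, φ (Pi.single f 1) ≤ 0 := by
    intro f
    by_contra! hpos
    have h1 := hcl (((c + 1) / φ (Pi.single f 1)) • Pi.single f 1) fun f' => by
      rcases eq_or_ne f' f with rfl | hne
      · simp; positivity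
      · simp [hne]
    rw [map_smul, smul_eq_mul, div_mul_cancel₀ _ hpos.ne'] at h1
    linarith
  have hsum : 0 < ∑ f, -φ (Pi.single f 1) := by
    have h1 : φ 1 < c := hφ 1 fun _ _ => by simp
    obtain ⟨d, hd⟩ := hne
    have h0 : ∀ f, 0 ≤ -φ (Pi.single f 1) := fun f => neg_nonneg.2 (hw f)
    rcases (Finset.sum_nonneg fun f (_ : f ∈ Finset.univ) => h0 f).lt_or_eq with h2 | h2
    · exact h2
    · have h3 : ∀ f, φ (Pi.single f 1) = 0 := fun f => by
        simpa using (Finset.sum_eq_zero_iff_of_nonneg fun f _ => h0 f).1 h2.symm f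
          (Finset.mem_univ f)
      have h4 : ∀ x, φ x = 0 := fun x => by rw [hexp]; simp [h3]
      have h5 := hc _ ⟨d, hd, rfl⟩
      rw [h4] at h1 h5
      linarith
  refine ⟨fun f => -φ (Pi.single f 1) / ∑ f, -φ (Pi.single f 1),
    fun f => div_nonneg (neg_nonneg.2 (hw f)) hsum.le, ?_, fun d hd => ?_⟩
  · rw [← Finset.sum_div, div_self hsum.ne']
  · have h1 := hc0.trans (hc _ ⟨d, hd, rfl⟩)
    rw [hexp] at h1
    simp only [LinearMap.pi_apply] at h1
    have h2 : ∑ f, -φ (Pi.single f 1) / (∑ f, -φ (Pi.single f 1)) * l f d =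
        -(∑ f, l f d * φ (Pi.single f 1)) / ∑ f, -φ (Pi.single f 1) := by
      rw [← Finset.sum_neg_distrib, Finset.sum_div]
      exact Finset.sum_congr rfl fun f _ => by ring
    rw [h2]
    exact div_nonpos_of_nonpos_of_nonneg (neg_nonpos.2 h1) hsum.le

/-! ### Random radii on a logarithmic scale -/

-- By periodicity, reducing a uniform offset modulo L into (c, c + L] keeps it uniform. With c = log
-- a this describes the logarithm of the rounded radius.
open MeasureTheory in
theorem intervalIntegrable_and_integral_comp_toIocMod {L : ℝ} (hL : 0 < L) (c : ℝ) {G : ℝ → ℝ}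
    (hG : IntervalIntegrable G volume c (c + L)) :
    IntervalIntegrable (fun u => G (toIocMod hL c u)) volume 0 L ∧
      ∫ u in (0 : ℝ)..L, G (toIocMod hL c u) = ∫ v in c..c + L, G v := by
  have hper : Function.Periodic (fun u => G (toIocMod hL c u)) L :=
    (toIocMod_periodic hL c).comp G
  have hle : c ≤ c + L := by linarith
  have heq : Set.EqOn G (fun u => G (toIocMod hL c u)) (Set.uIoc c (c + L)) := by
    intro v hv
    rw [Set.uIoc_of_le hle] at hv
    simp only [(toIocMod_eq_self hL).2 hv]
  constructor
  · exact hper.intervalIntegrable hL.ne' (t := c) (hG.congr heq) 0 L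
  · have h1 := hper.intervalIntegral_add_eq 0 c
    rw [zero_add] at h1
    rw [h1]
    exact (intervalIntegral.integral_congr_ae (Filter.Eventually.of_forall fun v hv => heq hv)).symm

open MeasureTheory in
theorem intervalIntegrable_indicator {a b : ℝ} {G : ℝ → ℝ} (hG : IntervalIntegrable G volume a b)
    {s : Set ℝ} (hs : MeasurableSet s) : IntervalIntegrable (s.indicator G) volume a b :=
  ⟨hG.1.indicator hs, hG.2.indicator hs⟩

open MeasureTheory in
theorem integral_indicator_Iic_const_le {c L e K : ℝ} (hL : 0 ≤ L) (hce : c ≤ e) (hK : 0 ≤ K) :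
    ∫ v in c..c + L, (Set.Iic e).indicator (fun _ => K) v ≤ K * (e - c) := by
  rw [intervalIntegral.integral_of_le (by linarith), setIntegral_indicator measurableSet_Iic,
    setIntegral_const, smul_eq_mul, mul_comm]
  have h1 : volume.real (Set.Ioc c (c + L) ∩ Set.Iic e) ≤ volume.real (Set.Ioc c e) :=
    measureReal_mono (fun v hv => ⟨hv.1.1, hv.2⟩) (by simp)
  rw [Real.volume_real_Ioc_of_le hce] at h1
  gcongr

-- Substituting R = exp v turns exp v dv into dR, so weighting by the radius leaves just the window
-- length, whatever `m` is.
open MeasureTheory in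
theorem integral_indicator_exp_Ico_le {c L m δ : ℝ} (hL : 0 ≤ L) (hm : 0 < m) (hδ : 0 ≤ δ) :
    ∫ v in c..c + L, (Real.exp ⁻¹' Set.Ico m (m + δ)).indicator Real.exp v ≤ δ := by
  have hms : MeasurableSet (Real.exp ⁻¹' Set.Ico m (m + δ)) :=
    Real.measurable_exp measurableSet_Ico
  have hlog : Real.log m ≤ Real.log (m + δ) := Real.log_le_log hm (by linarith)
  have hint : IntegrableOn Real.exp (Set.Icc (Real.log m) (Real.log (m + δ))) :=
    Real.continuous_exp.integrableOn_Icc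
  rw [intervalIntegral.integral_of_le (by linarith), setIntegral_indicator hms]
  calc _ ≤ ∫ v in Set.Icc (Real.log m) (Real.log (m + δ)), Real.exp v := by
        refine setIntegral_mono_set hint
          (Filter.Eventually.of_forall fun v => (Real.exp_pos v).le)
          (LE.le.eventuallyLE fun v hv => ?_)
        exact ⟨(Real.log_le_iff_le_exp hm).2 hv.2.1,
          (Real.le_log_iff_exp_le (by linarith)).2 hv.2.2.le⟩
    _ = δ := by
        rw [integral_Icc_eq_integral_Ioc, ← intervalIntegral.integral_of_le hlog, integral_exp,
          Real.exp_log hm, Real.exp_log (by linarith)]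
        ring

/-- The least number of the form `exp (u + i * L)`, `i ∈ ℤ`, that exceeds `a > 0`. -/
noncomputable def roundedRadius {L : ℝ} (hL : 0 < L) (u a : ℝ) : ℝ :=
  -- At `a = 0` no grid value is least; the value 0 keeps the bounds and the integral formula below
  -- valid.
  if a = 0 then 0 else Real.exp (toIocMod hL (Real.log a) u)

theorem le_roundedRadius {L : ℝ} (hL : 0 < L) (u : ℝ) {a : ℝ} (ha : 0 ≤ a) :
    a ≤ roundedRadius hL u a := by
  unfold roundedRadius
  split_ifs with h
  · exact h.le
  · exact (Real.log_le_iff_le_exp (lt_of_le_of_ne ha (Ne.symm h))).1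
      (left_lt_toIocMod hL _ _).le

theorem roundedRadius_le {L : ℝ} (hL : 0 < L) (u : ℝ) {a : ℝ} (ha : 0 ≤ a) :
    roundedRadius hL u a ≤ Real.exp L * a := by
  unfold roundedRadius
  split_ifs with h
  · simp [h]
  · have h1 : 0 < a := lt_of_le_of_ne ha (Ne.symm h)
    calc _ ≤ Real.exp (Real.log a + L) := Real.exp_le_exp.2 (toIocMod_le_right hL _ _)
      _ = _ := by rw [Real.exp_add, Real.exp_log h1, mul_comm]

/-- No grid value lies in (a, b], so the next one above `a` is also the next above `b`. -/
theorem roundedRadius_eq {L : ℝ} (hL : 0 < L) (u : ℝ) {a b : ℝ} (ha : 0 < a) (hab : a ≤ b)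
    (h : b < roundedRadius hL u a) : roundedRadius hL u a = roundedRadius hL u b := by
  have hb : 0 < b := ha.trans_le hab
  unfold roundedRadius at h ⊢
  rw [if_neg ha.ne'] at h ⊢
  rw [if_neg hb.ne']
  congr 1
  obtain ⟨h1, z, h2⟩ := (toIocMod_eq_iff hL (c := toIocMod hL (Real.log a) u)).1 rfl
  symm
  refine (toIocMod_eq_iff hL).2 ⟨⟨(Real.log_lt_iff_lt_exp hb).2 h, h1.2.trans ?_⟩, z, h2⟩
  gcongr

open MeasureTheory in
theorem intervalIntegrable_and_integral_roundedRadius {L : ℝ} (hL : 0 < L) {a : ℝ} (ha : 0 ≤ a) :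
    IntervalIntegrable (fun u => roundedRadius hL u a) volume 0 L ∧
      ∫ u in (0 : ℝ)..L, roundedRadius hL u a = a * (Real.exp L - 1) := by
  rcases ha.eq_or_lt with rfl | h
  · simp [roundedRadius]
  · simp only [roundedRadius, if_neg h.ne']
    have := intervalIntegrable_and_integral_comp_toIocMod hL (Real.log a) (G := Real.exp)
      (Real.continuous_exp.intervalIntegrable _ _)
    refine ⟨this.1, this.2.trans ?_⟩
    rw [integral_exp, Real.exp_add, Real.exp_log h]
    ring

theorem harmonic_nonneg (k : ℕ) : (0 : ℝ) ≤ harmonic k := by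
  unfold harmonic
  positivity

/-! ### Rounding one semimetric to a retraction -/

open MeasureTheory Finset in
/-- Two points `x`, `y` at distances `a ≤ b` from the targets, each choosing the first target in a
random order within its rounded radius, choose targets whose expected distance over `σ` is bounded
by an explicit function of the offset `u`. -/
theorem exists_intervalIntegrable_bound {X T : Type*} [Fintype T] [DecidableEq T]
    {d : X → X → ℝ} (hd : IsSemimetric d) (e : T → X) {L : ℝ} (hL : 0 < L) {x y : X} {a b : ℝ}
    (ha : 0 ≤ a) (hab : a ≤ b) (hba : b ≤ a + d x y)
    (hpa : ∀ t, a ≤ d x (e t)) (hqb : ∀ t, b ≤ d y (e t))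
    (g h : ℝ → (T ≃ Fin (Fintype.card T)) → T)
    (hg : ∀ u σ, d x (e (g u σ)) ≤ roundedRadius hL u a)
    (hg' : 0 < a → ∀ u (σ : T ≃ Fin (Fintype.card T)) t,
      d x (e t) ≤ roundedRadius hL u a → σ (g u σ) ≤ σ t)
    (hh : ∀ u σ, d y (e (h u σ)) ≤ roundedRadius hL u b)
    (hh' : 0 < b → ∀ u (σ : T ≃ Fin (Fintype.card T)) t,
      d y (e t) ≤ roundedRadius hL u b → σ (h u σ) ≤ σ t) :
    ∃ H : ℝ → ℝ, IntervalIntegrable H volume 0 L ∧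
      ∫ u in (0 : ℝ)..L, H u ≤
        (L + 4 * Real.exp L + 2 * harmonic (Fintype.card T)) * d x y ∧
      ∀ u, ∑ σ, d (e (g u σ)) (e (h u σ)) ≤
        Fintype.card (T ≃ Fin (Fintype.card T)) * H u := by
  set δ := d x y with hδ
  set N : ℝ := ((Fintype.card (T ≃ Fin (Fintype.card T)) : ℕ) : ℝ) with hN
  have hN0 : 0 ≤ N := Nat.cast_nonneg _
  have hδ0 : 0 ≤ δ := hd.nonneg _ _
  have hb : 0 ≤ b := ha.trans hab
  have hexp : 1 ≤ Real.exp L := Real.one_le_exp hL.le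
  have hharm : (0 : ℝ) ≤ harmonic (Fintype.card T) :=
    harmonic_nonneg _
  have htri : ∀ u σ, d (e (g u σ)) (e (h u σ)) ≤
      δ + roundedRadius hL u a + roundedRadius hL u b := by
    intro u σ
    have h1 := hd.triangle (e (g u σ)) x (e (h u σ))
    have h2 := hd.triangle x y (e (h u σ))
    rw [hd.symm (e (g u σ)) x] at h1
    linarith [hg u σ, hh u σ]
  have hsumle : ∀ u c, (∀ σ, d (e (g u σ)) (e (h u σ)) ≤ c) →
      ∑ σ, d (e (g u σ)) (e (h u σ)) ≤ N * c := by
    intro u c hc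
    refine (sum_le_sum fun σ _ => hc σ).trans ?_
    simp [hN]
  -- If b ≤ 2δ, the triangle inequality through x and y suffices: the radii integrate to (a + b)(e^L
  -- - 1) ≤ 4δ(e^L - 1). Otherwise a ≥ b - δ > b/2.
  rcases le_or_gt b (2 * δ) with hcase | hcase
  · obtain ⟨ia, ja⟩ := intervalIntegrable_and_integral_roundedRadius hL ha
    obtain ⟨ib, jb⟩ := intervalIntegrable_and_integral_roundedRadius hL hb
    refine ⟨fun u => δ + roundedRadius hL u a + roundedRadius hL u b,
      (intervalIntegrable_const.add ia).add ib, ?_, fun u => hsumle u _ (htri u)⟩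
    rw [intervalIntegral.integral_add (intervalIntegrable_const.add ia) ib,
      intervalIntegral.integral_add intervalIntegrable_const ia, ja, jb,
      intervalIntegral.integral_const, smul_eq_mul]
    nlinarith [mul_nonneg hharm hδ0,
      mul_nonneg (by linarith : 0 ≤ 4 * δ - a - b) (by linarith : 0 ≤ Real.exp L - 1)]
  · have ha' : 0 < a := by linarith
    have hb' : 0 < b := by linarith
    let m : T → ℝ := fun t => min (d x (e t)) (d y (e t))
    let s : T → ℝ := fun t => ((univ.filter fun t' => m t' ≤ m t).card : ℝ)⁻¹
    have hs : ∀ t, 0 ≤ s t := fun t => by positivity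
    have hm : ∀ t, 0 < m t := fun t => lt_min (ha'.trans_le (hpa t)) (hb'.trans_le (hqb t))
    -- `K` bounds the sum of the two radii when the radius of x is at most b. `G₁` charges that
    -- event; `G₂ t` charges twice the common radius, after weighting, when it lies in the window of
    -- `t`.
    let K : ℝ := (1 + Real.exp L) * b
    have hK : 0 ≤ K := by positivity
    let G₁ : ℝ → ℝ := (Set.Iic (Real.log b)).indicator fun _ => K
    let G₂ : T → ℝ → ℝ := fun t => (Real.exp ⁻¹' Set.Ico (m t) (m t + δ)).indicator Real.exp
    let G : ℝ → ℝ := fun v => δ + G₁ v + ∑ t, 2 * s t * G₂ t v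
    have i1 : IntervalIntegrable G₁ volume (Real.log a) (Real.log a + L) :=
      intervalIntegrable_indicator intervalIntegrable_const measurableSet_Iic
    have i2 : ∀ t, IntervalIntegrable (G₂ t) volume (Real.log a) (Real.log a + L) := fun t =>
      intervalIntegrable_indicator (Real.continuous_exp.intervalIntegrable _ _)
        (Real.measurable_exp measurableSet_Ico)
    have i3 : IntervalIntegrable (fun v => ∑ t, 2 * s t * G₂ t v) volume
        (Real.log a) (Real.log a + L) := by
      have := IntervalIntegrable.sum univ fun t _ => (i2 t).const_mul (2 * s t)
      have h0 : (fun v => ∑ t, 2 * s t * G₂ t v) = ∑ t, fun v => 2 * s t * G₂ t v := by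
        ext v
        rw [Finset.sum_apply]
      rwa [h0]
    have iG := (intervalIntegrable_const (c := δ)).add i1 |>.add i3
    obtain ⟨jH, kH⟩ := intervalIntegrable_and_integral_comp_toIocMod hL (Real.log a) (G := G) iG
    have hlog : Real.log b - Real.log a ≤ δ / a := by
      rw [← Real.log_div hb'.ne' ha'.ne']
      refine (Real.log_le_sub_one_of_pos (by positivity)).trans ?_
      rw [div_sub_one ha'.ne']
      gcongr
      linarith
    have hG1 : ∫ v in Real.log a..Real.log a + L, G₁ v ≤ 4 * Real.exp L * δ := by
      refine (integral_indicator_Iic_const_le hL.le (Real.log_le_log ha' hab) hK).trans ?_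
      calc K * (Real.log b - Real.log a) ≤ (2 * Real.exp L * (2 * a)) * (δ / a) := by
            have : K ≤ 2 * Real.exp L * (2 * a) := by
              simp only [K]
              gcongr <;> linarith
            have h0 : 0 ≤ Real.log b - Real.log a := sub_nonneg.2 (Real.log_le_log ha' hab)
            gcongr
        _ = _ := by field_simp; ring
    have hG2 : ∫ v in Real.log a..Real.log a + L, ∑ t, 2 * s t * G₂ t v ≤
        2 * harmonic (Fintype.card T) * δ := by
      rw [intervalIntegral.integral_finsetSum fun t _ => (i2 t).const_mul (2 * s t)]
      calc _ ≤ ∑ t, 2 * s t * δ := by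
            refine sum_le_sum fun t _ => ?_
            rw [intervalIntegral.integral_const_mul]
            exact mul_le_mul_of_nonneg_left
              (integral_indicator_exp_Ico_le hL.le (hm t) hδ0) (by linarith [hs t])
        _ = 2 * (∑ t, s t) * δ := by rw [← sum_mul, ← mul_sum]
        _ ≤ _ := by
            have := sum_inv_card_filter_le_harmonic m univ
            rw [card_univ] at this
            gcongr
    refine ⟨_, jH, ?_, fun u => ?_⟩
    · rw [kH, intervalIntegral.integral_add (intervalIntegrable_const.add i1) i3,
        intervalIntegral.integral_add intervalIntegrable_const i1,
        intervalIntegral.integral_const, smul_eq_mul]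
      linarith
    · set v := toIocMod hL (Real.log a) u with hv
      have hR : roundedRadius hL u a = Real.exp v := if_neg ha'.ne'
      have hG2nn : ∀ t, 0 ≤ 2 * s t * G₂ t v := fun t =>
        mul_nonneg (by linarith [hs t]) (Set.indicator_nonneg (fun v _ => (Real.exp_pos v).le) v)
      rcases le_or_gt (roundedRadius hL u a) b with hle | hlt
      · refine hsumle u _ fun σ => (htri u σ).trans ?_
        have h0 : v ∈ Set.Iic (Real.log b) := (Real.le_log_iff_exp_le hb').2 (hR ▸ hle)
        have h1 : G₁ v = K := Set.indicator_of_mem h0 _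
        have h2 : 0 ≤ ∑ t, 2 * s t * G₂ t v := sum_nonneg fun t _ => hG2nn t
        have h3 := roundedRadius_le hL u hb
        simp only [G, h1, K]
        linarith
      -- Both radii now equal exp v, so only orders separating the two choices cost anything, each
      -- at most δ + 2 exp v.
      · have heq := roundedRadius_eq hL u ha' hab hlt
        have hpq : ∀ t, |d x (e t) - d y (e t)| ≤ δ := by
          intro t
          have h1 := hd.triangle x y (e t)
          have h2 := hd.triangle y x (e t)
          rw [hd.symm y x] at h2
          exact abs_le.2 ⟨by linarith, by linarith⟩
        have hcard := card_filter_first_ne_le (p := fun t => d x (e t)) (q := fun t => d y (e t))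
          hpq (g u) (h u) (hg u) (hg' ha' u) (fun σ => heq ▸ hh u σ)
          (fun σ t ht => hh' hb' u σ t (heq ▸ ht))
        have hcard2 : ((univ.filter fun σ => g u σ ≠ h u σ).card : ℝ) ≤ N :=
          Nat.cast_le.2 (card_le_univ _)
        set c : ℝ := ((univ.filter fun σ => g u σ ≠ h u σ).card : ℝ) with hc
        have hR0 : 0 ≤ Real.exp v := (Real.exp_pos v).le
        have h1 : ∑ σ, d (e (g u σ)) (e (h u σ)) ≤ c * (δ + 2 * Real.exp v) := by
          calc _ ≤ ∑ σ, if g u σ ≠ h u σ then δ + 2 * Real.exp v else 0 := by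
                refine sum_le_sum fun σ _ => ?_
                split_ifs with h1
                · have := htri u σ
                  rw [← heq, hR] at this
                  linarith
                · rw [not_not.1 h1, hd.self]
            _ = _ := by rw [← sum_filter, sum_const, nsmul_eq_mul]
        have h2 : ∑ t, 2 * s t * G₂ t v = 2 * Real.exp v * ∑ t, s t *
            (if m t ≤ roundedRadius hL u a ∧ roundedRadius hL u a < m t + δ then 1 else 0) := by
          rw [mul_sum]
          refine sum_congr rfl fun t _ => ?_
          simp only [G₂, Set.indicator, Set.mem_preimage, Set.mem_Ico, hR]
          split_ifs <;> ring
        have h3 : 0 ≤ G₁ v := Set.indicator_nonneg (fun _ _ => hK) v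
        have h4 : c * (2 * Real.exp v) ≤ N * ∑ t, 2 * s t * G₂ t v := by
          rw [h2]
          refine (mul_le_mul_of_nonneg_right hcard (by positivity)).trans_eq ?_
          rw [mul_assoc, mul_comm _ (2 * Real.exp v)]
        calc _ ≤ _ := h1
          _ = c * δ + c * (2 * Real.exp v) := by ring
          _ ≤ N * δ + N * ∑ t, 2 * s t * G₂ t v := by gcongr
          _ ≤ N * G v := by
            simp only [G]
            nlinarith [mul_nonneg hN0 h3]

open MeasureTheory Finset in
/-- A minimum `0`-extension is at most `O(log k / log log k)` times as expensive as any semimetric;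
`L` is a parameter to be optimised. -/
theorem exists_retraction_metricCost_le {X : Type*} [Fintype X] {Y : Finset X} [Nonempty Y]
    {α d : X → X → ℝ} (hα : ∀ i j, 0 ≤ α i j) (hd : IsSemimetric d) {L : ℝ} (hL : 0 < L) :
    ∃ r : X → Y, (∀ y : Y, r y = y) ∧ metricCost α (fun i j => d (r i) (r j)) ≤
      (1 + (4 * Real.exp L + 2 * harmonic Y.card) / L) * metricCost α d := by
  classical
  have hn : ∀ x, ∃ t : Y, ∀ t' : Y, d x t ≤ d x t' := fun x => by
    obtain ⟨t, -, ht⟩ := exists_min_image (univ : Finset Y) (fun t => d x t) univ_nonempty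
    exact ⟨t, fun t' => ht t' (mem_univ _)⟩
  choose n hn using hn
  let A : X → ℝ := fun x => d x (n x)
  have hA : ∀ x, 0 ≤ A x := fun x => hd.nonneg _ _
  -- Points of Y must stay fixed even if another target at distance 0 comes earlier, so the
  -- first-in-order rule is claimed only for `0 < A x`.
  have hr : ∀ (u : ℝ) (σ : Y ≃ Fin (Fintype.card Y)) (x : X), ∃ t : Y,
      (∀ y : Y, (y : X) = x → t = y) ∧ d x t ≤ roundedRadius hL u (A x) ∧
      (0 < A x → ∀ t' : Y, d x t' ≤ roundedRadius hL u (A x) → σ t ≤ σ t') := by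
    intro u σ x
    by_cases hx : x ∈ Y
    · have hAx : A x = 0 := le_antisymm ((hn x ⟨x, hx⟩).trans_eq (hd.self x)) (hA x)
      refine ⟨⟨x, hx⟩, fun y hy => Subtype.ext hy.symm, ?_, fun h => absurd h hAx.not_gt⟩
      exact (hd.self x).trans_le ((hA x).trans (le_roundedRadius hL u (hA x)))
    · obtain ⟨t, ht, htm⟩ := exists_min_image
        ((univ : Finset Y).filter fun t : Y => d x t ≤ roundedRadius hL u (A x)) σ
        ⟨n x, by simpa using le_roundedRadius hL u (hA x)⟩
      refine ⟨t, fun y hy => absurd (hy ▸ y.2) hx, (mem_filter.1 ht).2, fun _ t' ht' => ?_⟩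
      exact htm t' (by simpa using ht')
  choose r hr1 hr2 hr3 using hr
  set N : ℝ := ((Fintype.card (Y ≃ Fin (Fintype.card Y)) : ℕ) : ℝ) with hN
  have hcardY : Fintype.card Y = Y.card := Fintype.card_coe Y
  have hN0 : 0 < N := by
    rw [hN]
    exact_mod_cast Fintype.card_pos_iff.2 ⟨Fintype.equivFin Y⟩
  have hH : ∀ x y, ∃ H : ℝ → ℝ, IntervalIntegrable H volume 0 L ∧
      ∫ u in (0 : ℝ)..L, H u ≤ (L + 4 * Real.exp L + 2 * harmonic (Fintype.card Y)) * d x y ∧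
      ∀ u, ∑ σ, d (r u σ x) (r u σ y) ≤ N * H u := by
    have key : ∀ x y, A x ≤ A y → ∃ H : ℝ → ℝ, IntervalIntegrable H volume 0 L ∧
        ∫ u in (0 : ℝ)..L, H u ≤ (L + 4 * Real.exp L + 2 * harmonic (Fintype.card Y)) * d x y ∧
        ∀ u, ∑ σ, d (r u σ x) (r u σ y) ≤ N * H u := by
      intro x y hxy
      refine exists_intervalIntegrable_bound hd (fun t : Y => (t : X)) hL (hA x) hxy ?_ (hn x)
        (hn y) (fun u σ => r u σ x) (fun u σ => r u σ y) (fun u σ => hr2 u σ x)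
        (fun h u σ => hr3 u σ x h) (fun u σ => hr2 u σ y) (fun h u σ => hr3 u σ y h)
      have h1 := hn y (n x)
      have h2 := hd.triangle y x (n x)
      rw [hd.symm y x] at h2
      simp only [A]
      linarith
    intro x y
    rcases le_total (A x) (A y) with h | h
    · exact key x y h
    · obtain ⟨H, h1, h2, h3⟩ := key y x h
      refine ⟨H, h1, hd.symm x y ▸ h2, fun u => ?_⟩
      simpa only [hd.symm (r u _ x)] using h3 u
  choose H hHi hHle hHbd using hH
  set c : ℝ := (1 + (4 * Real.exp L + 2 * harmonic Y.card) / L) * metricCost α d with hc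
  -- Averaging over the offset fixes `u`; averaging over orders then fixes `σ`.
  obtain ⟨u, hu⟩ : ∃ u, ∑ i, ∑ j, α i j * H i j u ≤ c := by
    by_contra! hcon
    have hi1 : ∀ i j, IntervalIntegrable (fun u => α i j * H i j u) volume 0 L := fun i j =>
      (hHi i j).const_mul _
    have hi2 : ∀ i, IntervalIntegrable (fun u => ∑ j, α i j * H i j u) volume 0 L := fun i => by
      have := IntervalIntegrable.sum univ fun j _ => hi1 i j
      have h0 : (fun u => ∑ j, α i j * H i j u) = ∑ j, fun u => α i j * H i j u := by
        ext v
        rw [Finset.sum_apply]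
      rwa [h0]
    have hi3 : IntervalIntegrable (fun u => ∑ i, ∑ j, α i j * H i j u) volume 0 L := by
      have := IntervalIntegrable.sum univ fun i _ => hi2 i
      have h0 : (fun u => ∑ i, ∑ j, α i j * H i j u) = ∑ i, fun u => ∑ j, α i j * H i j u := by
        ext v
        rw [Finset.sum_apply]
      rwa [h0]
    have hpos := intervalIntegral.intervalIntegral_pos_of_pos
      (hi3.sub (intervalIntegrable_const (c := c))) (fun u => sub_pos.2 (hcon u)) hL
    rw [intervalIntegral.integral_sub hi3 intervalIntegrable_const,
      intervalIntegral.integral_finsetSum fun i _ => hi2 i,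
      intervalIntegral.integral_const, smul_eq_mul, sub_zero] at hpos
    have hle : ∑ i, ∫ u in (0 : ℝ)..L, ∑ j, α i j * H i j u ≤ L * c := by
      calc _ = ∑ i, ∑ j, α i j * ∫ u in (0 : ℝ)..L, H i j u := by
            refine sum_congr rfl fun i _ => ?_
            rw [intervalIntegral.integral_finsetSum fun j _ => hi1 i j]
            simp_rw [intervalIntegral.integral_const_mul]
        _ ≤ ∑ i, ∑ j, α i j *
            ((L + 4 * Real.exp L + 2 * harmonic (Fintype.card Y)) * d i j) :=
            sum_le_sum fun i _ => sum_le_sum fun j _ =>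
              mul_le_mul_of_nonneg_left (hHle i j) (hα i j)
        _ = (L + 4 * Real.exp L + 2 * harmonic (Fintype.card Y)) * metricCost α d := by
            simp_rw [metricCost, mul_sum]
            exact sum_congr rfl fun i _ => sum_congr rfl fun j _ => by ring
        _ = L * c := by
            rw [hc, hcardY]
            field_simp
            ring
    linarith
  have hsum : ∑ σ, metricCost α (fun i j => d (r u σ i) (r u σ j)) ≤
      ∑ _σ : Y ≃ Fin (Fintype.card Y), c := by
    simp only [metricCost]
    rw [sum_comm]
    calc _ = ∑ i, ∑ j, α i j * ∑ σ, d (r u σ i) (r u σ j) := by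
          refine sum_congr rfl fun i _ => ?_
          rw [sum_comm]
          simp_rw [mul_sum]
      _ ≤ ∑ i, ∑ j, α i j * (N * H i j u) :=
          sum_le_sum fun i _ => sum_le_sum fun j _ =>
            mul_le_mul_of_nonneg_left (hHbd i j u) (hα i j)
      _ = N * ∑ i, ∑ j, α i j * H i j u := by
          simp_rw [mul_sum]
          exact sum_congr rfl fun i _ => sum_congr rfl fun j _ => by ring
      _ ≤ N * c := by gcongr
      _ = _ := by rw [sum_const, card_univ, nsmul_eq_mul]
  obtain ⟨σ, -, hσ⟩ := exists_le_of_sum_le ⟨Fintype.equivFin Y, mem_univ _⟩ hsum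
  exact ⟨r u σ, fun y => hr1 u σ y y rfl, hσ⟩

/-! ### From retractions to a linear operator -/

-- Retractions chosen separately for each `d` are traded for one distribution `w`, since the excess
-- cost is linear in `d` and semimetrics form a convex set.
open Finset in
theorem exists_isMetricExtensionOperator {X : Type*} [Fintype X] {Y : Finset X} [Nonempty Y]
    {α : X → X → ℝ} (hα : ∀ i j, 0 ≤ α i j) {Q : ℝ}
    (hQ : ∀ d : X → X → ℝ, IsSemimetric d → ∃ r : X → Y, (∀ y : Y, r y = y) ∧
      metricCost α (fun i j => d (r i) (r j)) ≤ Q * metricCost α d) :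
    ∃ φ : X → Y → X → Y → ℝ, IsMetricExtensionOperator α Q φ := by
  classical
  let F := {r : X → Y // ∀ y : Y, r y = y}
  let C : Set (X → X → ℝ) := {d | IsSemimetric d}
  have hC : Convex ℝ C := by
    intro d hd d' hd' s t hs ht _
    refine ⟨fun i j => ?_, fun i => ?_, fun i j => ?_, fun i j k => ?_⟩ <;>
      simp only [Pi.add_apply, Pi.smul_apply, smul_eq_mul]
    · exact add_nonneg (mul_nonneg hs (hd.nonneg i j)) (mul_nonneg ht (hd'.nonneg i j))
    · rw [hd.self, hd'.self, mul_zero, mul_zero, add_zero]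
    · rw [hd.symm, hd'.symm]
    · nlinarith [mul_le_mul_of_nonneg_left (hd.triangle i j k) hs,
        mul_le_mul_of_nonneg_left (hd'.triangle i j k) ht]
  have hne : C.Nonempty := ⟨0, by simp, by simp, by simp, by simp⟩
  let l : F → (X → X → ℝ) →ₗ[ℝ] ℝ := fun r =>
    { toFun := fun d => metricCost α (fun i j => d (r.1 i) (r.1 j)) - Q * metricCost α d
      map_add' := fun d d' => by
        simp only [metricCost, Pi.add_apply, mul_add, sum_add_distrib]
        ring
      map_smul' := fun c d => by
        simp only [metricCost, Pi.smul_apply, smul_eq_mul, RingHom.id_apply, mul_left_comm _ c,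
          ← mul_sum]
        ring }
  obtain ⟨w, hw0, hw1, hw⟩ := exists_convex_combination_nonpos hC hne l fun d hd => by
    obtain ⟨r, hr, hle⟩ := hQ d hd
    exact ⟨⟨r, hr⟩, sub_nonpos.2 hle⟩
  -- The coefficient is the probability that i goes to p and j to q.
  let φ : X → Y → X → Y → ℝ := fun i p j q =>
    ∑ r : F, w r * if r.1 i = p ∧ r.1 j = q then 1 else 0
  have happ : ∀ (dY : Y → Y → ℝ) i j,
      applyOperator φ dY i j = ∑ r : F, w r * dY (r.1 i) (r.1 j) := by
    intro dY i j
    simp only [applyOperator, φ, sum_mul]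
    simp_rw [sum_comm (s := (univ : Finset Y)) (t := (univ : Finset F))]
    refine sum_congr rfl fun r _ => ?_
    simp [ite_and]
  refine ⟨φ, fun dY hdY => ⟨⟨fun i j => ?_, fun i => ?_, fun i j => ?_, fun i j k => ?_⟩,
    fun p q => ?_⟩, fun dY hdY => ?_, fun i p j q => ?_⟩
  · rw [happ]
    exact sum_nonneg fun r _ => mul_nonneg (hw0 r) (hdY.nonneg _ _)
  · rw [happ]
    exact sum_eq_zero fun r _ => by rw [hdY.self, mul_zero]
  · rw [happ, happ]
    exact sum_congr rfl fun r _ => by rw [hdY.symm]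
  · rw [happ, happ, happ, ← sum_add_distrib]
    refine sum_le_sum fun r _ => ?_
    rw [← mul_add]
    exact mul_le_mul_of_nonneg_left (hdY.triangle _ _ _) (hw0 r)
  · rw [happ]
    have : ∀ r : F, w r * dY (r.1 p) (r.1 q) = w r * dY p q := fun r => by rw [r.2, r.2]
    rw [sum_congr rfl fun r _ => this r, ← sum_mul, hw1, one_mul]
  -- The pullback sees `dX` only on Y, where it is `dY`, so the bound for a cheapest extension `dX`
  -- is the distortion bound.
  · obtain ⟨dX, hdX, hmin⟩ := (isLeast_minExt hdY hα).1
    have h1 := hw dX hdX.isSemimetric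
    have h2 : metricCost α (applyOperator φ dY) =
        ∑ r : F, w r * metricCost α (fun i j => dX (r.1 i) (r.1 j)) := by
      simp only [metricCost, happ, hdX.restrict_eq, mul_sum]
      symm
      rw [sum_comm]
      refine sum_congr rfl fun i _ => ?_
      rw [sum_comm]
      exact sum_congr rfl fun j _ => sum_congr rfl fun r _ => by ring
    have h3 : ∑ r : F, w r * l r dX = (∑ r : F, w r * metricCost α
        (fun i j => dX (r.1 i) (r.1 j))) - Q * metricCost α dX := by
      simp only [l, LinearMap.coe_mk, AddHom.coe_mk, mul_sub, sum_sub_distrib]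
      rw [← sum_mul, hw1, one_mul]
    rw [h3] at h1
    rw [h2, ← hmin]
    linarith
  · exact sum_nonneg fun r _ => mul_nonneg (hw0 r) (by split_ifs <;> norm_num)

/-- A nonempty X has no retraction onto an empty Y, hence the separate case. -/
theorem isMetricExtensionOperator_zero {X : Type*} [Fintype X] {Y : Finset X} [IsEmpty Y]
    {α : X → X → ℝ} (hα : ∀ i j, 0 ≤ α i j) {Q : ℝ} (hQ : 0 ≤ Q) :
    IsMetricExtensionOperator α Q (fun (_ : X) (_ : Y) (_ : X) (_ : Y) => 0) := by
  refine ⟨fun dY _ => ⟨?_, fun p => isEmptyElim p⟩, fun dY hdY => ?_, fun _ _ _ _ => le_rfl⟩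
  · constructor <;> simp [applyOperator]
  · obtain ⟨dX, hdX, hmin⟩ := (isLeast_minExt hdY hα).1
    have h1 : 0 ≤ minExt dY α := hmin ▸ Finset.sum_nonneg fun i _ => Finset.sum_nonneg fun j _ =>
      mul_nonneg (hα i j) (hdX.isSemimetric.nonneg i j)
    simpa [metricCost, applyOperator] using mul_nonneg hQ h1

/-! ### Choice of the ratio and asymptotics -/

/-- The distortion obtained by rounding to radii whose successive ratio is `max e (log k)`. -/
noncomputable def distortionBound (k : ℕ) : ℝ :=
  1 + (4 * Real.exp (Real.log (max (Real.exp 1) (Real.log k))) + 2 * harmonic k) /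
    Real.log (max (Real.exp 1) (Real.log k))

theorem log_max_exp_one_pos (x : ℝ) : 0 < Real.log (max (Real.exp 1) x) :=
  Real.log_pos (lt_max_of_lt_left (Real.one_lt_exp_iff.2 one_pos))

theorem distortionBound_nonneg (k : ℕ) : 0 ≤ distortionBound k := by
  have h1 := log_max_exp_one_pos (Real.log k)
  have h2 := harmonic_nonneg k
  unfold distortionBound
  positivity

theorem distortionBound_isBigO :
    distortionBound =O[Filter.atTop]
      (fun k : ℕ => Real.log k / Real.log (Real.log k)) := by
  -- Once log k ≥ e, multiplying the bound by log log k gives at most log log k + 4 log k + 2(1 +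
  -- log k), which is at most (1 + 4 + 4) log k.
  refine Asymptotics.IsBigO.of_bound 9 ?_
  have htend : Filter.Tendsto (fun k : ℕ => Real.log k) Filter.atTop Filter.atTop :=
    Real.tendsto_log_atTop.comp tendsto_natCast_atTop_atTop
  filter_upwards [htend.eventually_ge_atTop (Real.exp 1)] with k hk
  have h1 : 1 ≤ Real.log k := (Real.one_le_exp zero_le_one).trans hk
  have h0 : 0 < Real.log k := by linarith
  have h2 : 0 < Real.log (Real.log k) :=
    one_pos.trans_le ((Real.le_log_iff_exp_le h0).2 hk)
  have h3 : Real.log (Real.log k) ≤ Real.log k := by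
    linarith [Real.log_le_sub_one_of_pos h0]
  rw [Real.norm_of_nonneg (distortionBound_nonneg k), Real.norm_of_nonneg (by positivity),
    distortionBound, max_eq_right hk, Real.exp_log h0, ← mul_div_assoc, le_div_iff₀ h2, add_mul,
    div_mul_cancel₀ _ h2.ne']
  linarith [harmonic_le_one_add_log k]

theorem mainTheorem2 :
    ∃ Q : ℕ → ℝ,
      Q =O[Filter.atTop] (fun k : ℕ => Real.log k / Real.log (Real.log k)) ∧
      ∀ (X : Type*) [Fintype X] (Y : Finset X) (α : X → X → ℝ), (∀ i j, 0 ≤ α i j) →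
        ∃ φ : X → Y → X → Y → ℝ, IsMetricExtensionOperator α (Q Y.card) φ := by
  refine ⟨distortionBound, distortionBound_isBigO, fun X _ Y α hα => ?_⟩
  rcases isEmpty_or_nonempty Y with hY | hY
  · exact ⟨_, isMetricExtensionOperator_zero hα (distortionBound_nonneg _)⟩
  · exact exists_isMetricExtensionOperator hα fun d hd =>
      exists_retraction_metricCost_le hα hd (log_max_exp_one_pos _)
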